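/- For integers $\delta\ge\nu>\tau\ge 0$ define $E_1(\delta,\nu,\tau)$ recursively by $$E_1(\delta,\nu,0)=\delta-\nu+1,\qquad E_1(\delta,\nu,\tau)=\delta+(\delta+2)\,E_1(\delta-1,\nu-1,\tau-1)\quad(\tau\ge 1).$$ Let $R$ be a commutative Noetherian ring of finite Krull dimension $d$ which is catenary and such that for every maximal ideal $\mathfrak m$ the local ring $R_{\mathfrak m}$ is equidimensional (i.e. $\dim R_{\mathfrak m}/P=\dim R_{\mathfrak m}$ for every minimal prime $P$ of $R_{\mathfrak m}$). Let $\boldsymbol{x}=x_1,\dots,x_n$ be a sequence of elements of $R$ such that $\operatorname{ht}\,(x_1,\dots,x_i)R\ge i$ for all $1\le i\le n$ (the unit ideal has height $\infty$). Let $M$ be a finitely generated $R$-module and let $c\in R$ be an element such that, for every $0\le i\le n-1$ and every prime ideal $\mathfrak p$ of $R$ containing $x_1,\dots,x_{i+1}$, $$c\,\mathrm H^i_{\mathfrak pR_{\mathfrak p}}(M_{\mathfrak p})=0 .$$ Then the Koszul homology of $\boldsymbol{x}$ with coefficients in $M$ satisfies $$c^{E_1(d,n,t)}\,\mathrm H_{n-t}(\boldsymbol{x};M)=0\qquad\text{for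 all } 0\le t\le n-1 .$$ (The hypotheses force $n\le d$ unless $(\boldsymbol{x})R=R$; for $n>d$, where $(d,n,t)$ is outside the domain of $E_1$, the recursion is read with all subtractions truncated at $0$.) -/

import Mathlib

open CategoryTheory

universe u

/-- A ring is catenary if any two saturated chains of primes with the same ends have the same
length. (In a Noetherian ring all such lengths are automatically bounded.) -/
def IsCatenaryRing (R : Type*) [CommRing R] : Prop :=
  ∀ s t : RelSeries {(p, q) : PrimeSpectrum R × PrimeSpectrum R | p ⋖ q},
    s.head = t.head → s.last = t.last → s.length = t.length

/-- A ring `A` is equidimensional if `dim A/P = dim A` for every minimal prime `P` of `A`. -/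
def IsEquidimensionalRing (A : Type*) [CommRing A] : Prop :=
  ∀ P ∈ minimalPrimes A, ringKrullDim (A ⧸ P) = ringKrullDim A

/-- The localization of `R` at every maximal ideal is equidimensional. -/
def IsLocallyEquidimensionalRing (R : Type*) [CommRing R] : Prop :=
  ∀ (m : Ideal R) [m.IsMaximal], IsEquidimensionalRing (Localization.AtPrime m)

/-- The function `E₁(δ, ν, τ)`. On its domain `δ ≥ ν > τ ≥ 0` no subtraction is truncated. -/
def koszulExponent (δ ν : ℕ) : ℕ → ℕ
  | 0 => δ + 1 - ν
  | τ + 1 => δ + (δ + 2) * koszulExponent (δ - 1) (ν - 1) τ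

section Koszul

variable {R : Type*} [CommRing R] {n : ℕ} (x : Fin n → R)

/-- The `i`-th term of the Koszul complex on `n` elements with coefficients in `M`: one copy of
`M` for each basis element `e_S = e_{s₁} ∧ ⋯ ∧ e_{sᵢ}`, `S = {s₁ < ⋯ < sᵢ}`. -/
abbrev KoszulTerm (n : ℕ) (M : Type*) (i : ℕ) : Type _ :=
  {S : Finset (Fin n) // S.card = i} → M

/-- The Koszul differential `m e_S ↦ ∑ₖ (-1)ᵏ x_{sₖ} m e_{S ∖ {sₖ}}` (with `S = {s₀ < s₁ < ⋯}`),
written through the coefficient at `T`, which is a sum over the sets `S = T ∪ {j}`. -/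
def koszulD (M : Type*) [AddCommGroup M] [Module R M] (i : ℕ) :
    KoszulTerm n M (i + 1) →ₗ[R] KoszulTerm n M i where
  toFun f := fun T => ∑ j : {j // j ∉ T.1},
    ((-1) ^ (T.1.filter (· < j.1)).card * x j.1) •
      f ⟨insert j.1 T.1, by rw [Finset.card_insert_of_notMem j.2, T.2]⟩
  map_add' f g := by
    funext T
    simp [smul_add, Finset.sum_add_distrib]
  map_smul' r f := by
    funext T
    simp [Finset.smul_sum, smul_comm r]

theorem koszulD_comp_koszulD (M : Type*) [AddCommGroup M] [Module R M] (i : ℕ) :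
    koszulD x M i ∘ₗ koszulD x M (i + 1) = 0 := by
  refine LinearMap.ext fun f => ?_
  funext T
  simp only [koszulD, LinearMap.comp_apply, LinearMap.coe_mk, AddHom.coe_mk, Finset.smul_sum,
    LinearMap.zero_apply, Pi.zero_apply, smul_smul]
  rw [← Fintype.sum_sigma']
  refine Finset.sum_involution
    (fun a _ => ⟨⟨a.2.1, fun h => a.2.2 (Finset.mem_insert_of_mem h)⟩, ⟨a.1.1, fun h => by
      rcases Finset.mem_insert.1 h with h | h
      · exact a.2.2 (by simp [h])
      · exact a.1.2 h⟩⟩) ?_ ?_ (fun _ _ => Finset.mem_univ _) ?_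
  · rintro ⟨⟨j, hj⟩, ⟨k, hk⟩⟩ -
    have hkj : k ≠ j := fun h => hk (by simp [h])
    have hkT : k ∉ T.1 := fun h => hk (Finset.mem_insert_of_mem h)
    have hS : insert k (insert j T.1) = insert j (insert k T.1) := Finset.insert_comm _ _ _
    simp only [hS, ← add_smul, Finset.filter_insert]
    convert zero_smul R _
    rcases lt_or_gt_of_ne hkj with h | h
    · rw [if_neg (not_lt.2 h.le), if_pos h, Finset.card_insert_of_notMem (by simp [hkT])]
      ring
    · rw [if_pos h, if_neg (not_lt.2 h.le), Finset.card_insert_of_notMem (by simp [hj])]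
      ring
  · rintro ⟨⟨j, hj⟩, ⟨k, hk⟩⟩ - - h
    have := congrArg (fun a => a.1.1) h
    exact hk (by simp at this; simp [this])
  · rintro ⟨⟨j, hj⟩, ⟨k, hk⟩⟩ -
    rfl

/-- The Koszul complex `K_•(x₁, …, xₙ; M)`. -/
noncomputable def koszulComplex (M : Type u) [AddCommGroup M] [Module R M] :
    ChainComplex (ModuleCat.{u} R) ℕ :=
  ChainComplex.of (fun i => ModuleCat.of R (KoszulTerm n M i))
    (fun i => ModuleCat.ofHom (koszulD x M i))
    (fun i => by
      rw [← ModuleCat.ofHom_comp, koszulD_comp_koszulD]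
      rfl)

/-- The Koszul homology `H_i(x₁, …, xₙ; M)`. -/
noncomputable abbrev koszulHomology (M : Type u) [AddCommGroup M] [Module R M] (i : ℕ) :
    ModuleCat.{u} R :=
  (koszulComplex x M).homology i

end Koszul

/-- The local cohomology module `H^i_{pR_p}(M_p)` of the `R_p`-module `M_p`. -/
noncomputable abbrev localCohomologyAtPrime {R : Type u} [CommRing R] (p : Ideal R) [p.IsPrime]
    (M : Type u) [AddCommGroup M] [Module R M] (i : ℕ) :
    ModuleCat.{u} (Localization.AtPrime p) :=
  (localCohomology (p.map (algebraMap R (Localization.AtPrime p))) i).obj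
    (ModuleCat.of (Localization.AtPrime p) (LocalizedModule p.primeCompl M))

/-! The proof is an induction on `t` fed by one annihilation principle. Let `y ∈ M` be such that the
primes containing its annihilator have height between `m` and `d`. If `c^k y` vanishes at all primes
of height less than `m + k`, then at a prime of height `m + k` it is torsion for the maximal ideal,
so it lies in `H^0` and `c` kills it there. Climbing through the heights gives `c^(d+1-m) y = 0`
(`pow_smul_eq_zero_of_localCohomologyKills`).

With `m = n` this settles the top Koszul homology, which consists of the elements killed by all
`x_j`. With `m = 1` it shows that `c^d` kills `ker x_1`. The sequences `0 → ker x_1 → M → x_1M → 0`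
and `0 → x_1M → M → M/x_1M → 0` then show that `c^(d+2)` can replace `c` for `M/x_1M` and `x_2, …,
x_n`. Finally, if `a` kills `H_i(x_2, …, x_n; M/x_1M)` and `b` kills `ker x_1`, then `ba` kills
`H_i(x; M)` for `i ≥ 1` (`KoszulKills.cons`). Together these give the recursion for `E₁`.

The ring stays fixed. The induction tracks the support of the module instead, with a shift `k`:
support primes containing the first `i` elements have height at least `k + i`, and all heights are
at most `k + δ`. -/

/-! ### Homology in the opposite of a module category, by elements -/

namespace HomologicalComplex

variable {R : Type*} [Ring R] {ι : Type*} {c : ComplexShape ι}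
  (K : HomologicalComplex (ModuleCat.{u} R)ᵒᵖ c) (i : ι)

/-- `Ext` is a left derived functor with values in the opposite category. There opcycles become
cocycles, `pOpcycles` their inclusion into cochains, and `homologyι` the passage to cohomology
classes. -/
theorem pOpcycles_unop_injective : Function.Injective (K.pOpcycles i).unop.hom :=
  (ModuleCat.mono_iff_injective _).1 inferInstance

theorem exists_pOpcycles_unop_eq (j : ι) (hj : c.prev i = j) (f : (K.X i).unop)
    (hf : (K.d j i).unop.hom f = 0) : ∃ z, (K.pOpcycles i).unop.hom z = f := by
  have h := (ShortComplex.exact_of_g_is_cokernel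
    (ShortComplex.mk _ _ (K.d_pOpcycles j i)) (K.opcyclesIsCokernel j i hj)).unop
  rw [ShortComplex.moduleCat_exact_iff] at h
  exact h f hf

theorem d_unop_pOpcycles_unop (j : ι) (z) :
    (K.d j i).unop.hom ((K.pOpcycles i).unop.hom z) = 0 := by
  rw [← ModuleCat.comp_apply, ← unop_comp, K.d_pOpcycles]
  rfl

theorem homologyι_unop_eq_zero_iff (j : ι) (hj : c.next i = j) (z) :
    (K.homologyι i).unop.hom z = 0 ↔
      ∃ g, (K.d i j).unop.hom g = (K.pOpcycles i).unop.hom z := by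
  have h := (ShortComplex.exact_of_f_is_kernel
    (ShortComplex.mk _ _ (K.homologyι_comp_fromOpcycles i j)) (K.homologyIsKernel i j hj)).unop
  have hc : ∀ g, (K.pOpcycles i).unop.hom ((K.fromOpcycles i j).unop.hom g) =
      (K.d i j).unop.hom g := fun g => by
    rw [← ModuleCat.comp_apply, ← unop_comp, K.p_fromOpcycles]
  constructor
  · intro hz
    rw [ShortComplex.moduleCat_exact_iff] at h
    obtain ⟨g, hg⟩ := h z hz
    refine ⟨g, ?_⟩
    rw [← hg]
    exact (hc g).symm
  · rintro ⟨g, hg⟩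
    rw [← hc] at hg
    rw [← K.pOpcycles_unop_injective i hg, ← ModuleCat.comp_apply, ← unop_comp,
      K.homologyι_comp_fromOpcycles]
    rfl

end HomologicalComplex

/-! ### Derived functors on the standard resolution -/

namespace CategoryTheory.Functor

variable {C : Type*} [Category* C] {D : Type*} [Category* D] [Abelian C]
  [HasProjectiveResolutions C] [Abelian D]

/-- The left derived functor as the homology of the image of the standard resolution. -/
noncomputable def leftDerivedIsoHomology (F : C ⥤ D) [F.Additive] (X : C) (i : ℕ) :
    (F.leftDerived i).obj X ≅
      ((F.mapHomologicalComplex _).obj (projectiveResolution X).complex).homology i :=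
  (projectiveResolution X).isoLeftDerivedObj F i

/-- The embedding of the left derived functor into the opcycles of the image of the standard
resolution. -/
noncomputable def leftDerivedToOpcycles (F : C ⥤ D) [F.Additive] (X : C) (i : ℕ) :
    (F.leftDerived i).obj X ⟶
      ((F.mapHomologicalComplex _).obj (projectiveResolution X).complex).opcycles i :=
  (F.leftDerivedIsoHomology X i).hom ≫ HomologicalComplex.homologyι _ i

instance (F : C ⥤ D) [F.Additive] (X : C) (i : ℕ) : Mono (F.leftDerivedToOpcycles X i) :=
  mono_comp _ _

theorem leftDerived_map_toOpcycles (F : C ⥤ D) [F.Additive] {X Y : C} (a : X ⟶ Y) (i : ℕ) :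
    (F.leftDerived i).map a ≫ F.leftDerivedToOpcycles Y i = F.leftDerivedToOpcycles X i ≫
      HomologicalComplex.opcyclesMap ((F.mapHomologicalComplex _).map
        (ProjectiveResolution.lift a (projectiveResolution X) (projectiveResolution Y))) i := by
  have h : (F.leftDerived i).map a ≫ (F.leftDerivedIsoHomology Y i).hom =
      (F.leftDerivedIsoHomology X i).hom ≫ HomologicalComplex.homologyMap
        ((F.mapHomologicalComplex _).map (ProjectiveResolution.lift a _ _)) i :=
    ProjectiveResolution.isoLeftDerivedObj_hom_naturality a (projectiveResolution X)
        (projectiveResolution Y) _ (ProjectiveResolution.lift_commutes_zero a _ _) F i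
  rw [leftDerivedToOpcycles, reassoc_of% h, HomologicalComplex.homologyι_naturality,
    leftDerivedToOpcycles, Category.assoc]

theorem leftDerived_app_toOpcycles {F G : C ⥤ D} [F.Additive] [G.Additive] (α : F ⟶ G) (X : C)
    (i : ℕ) :
    (NatTrans.leftDerived α i).app X ≫ G.leftDerivedToOpcycles X i = F.leftDerivedToOpcycles X i ≫
      HomologicalComplex.opcyclesMap ((NatTrans.mapHomologicalComplex α _).app
        (projectiveResolution X).complex) i := by
  have h : (NatTrans.leftDerived α i).app X = (F.leftDerivedIsoHomology X i).hom ≫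
      HomologicalComplex.homologyMap ((NatTrans.mapHomologicalComplex α _).app
        (projectiveResolution X).complex) i ≫ (G.leftDerivedIsoHomology X i).inv :=
    (projectiveResolution X).leftDerived_app_eq α i
  rw [leftDerivedToOpcycles, h]
  simp [leftDerivedToOpcycles]

end CategoryTheory.Functor

/-! ### Ext and local cohomology classes represented by cocycles -/

section LocalCohomology

open Opposite Limits

variable {R : Type u} [CommRing R]

/-- The cochain `f` on the standard projective resolution of `X` is a cocycle with class `z`. -/
def ExtRep {X M : ModuleCat.{u} R} {i : ℕ} (f : (projectiveResolution X).complex.X i ⟶ M)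
    (z : ((Ext R (ModuleCat.{u} R) i).obj (op X)).obj M) : Prop :=
  let F := ((linearYoneda R (ModuleCat.{u} R)).obj M).rightOp
  let K := (F.mapHomologicalComplex _).obj (projectiveResolution X).complex
  ∃ w : (K.opcycles i).unop, (K.pOpcycles i).unop.hom w = f ∧
    (F.leftDerivedToOpcycles X i).unop.hom w = z

namespace ExtRep

variable {X Y M N : ModuleCat.{u} R} {i : ℕ}

theorem exists_rep (z : ((Ext R (ModuleCat.{u} R) i).obj (op X)).obj M) :
    ∃ f, ExtRep f z := by
  have : Function.Surjective (((linearYoneda R (ModuleCat.{u} R)).obj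
      M).rightOp.leftDerivedToOpcycles X i).unop.hom :=
    (ModuleCat.epi_iff_surjective _).1 inferInstance
  obtain ⟨w, hw⟩ := this z
  exact ⟨_, w, rfl, hw⟩

theorem d_comp {f : (projectiveResolution X).complex.X i ⟶ M}
    {z : ((Ext R (ModuleCat.{u} R) i).obj (op X)).obj M} (h : ExtRep f z) (j : ℕ) :
    (projectiveResolution X).complex.d j i ≫ f = 0 := by
  obtain ⟨w, rfl, -⟩ := h
  exact HomologicalComplex.d_unop_pOpcycles_unop _ i j w

theorem exists_of_d_comp (f : (projectiveResolution X).complex.X i ⟶ M)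
    (hf : (projectiveResolution X).complex.d (i + 1) i ≫ f = 0) : ∃ z, ExtRep f z := by
  obtain ⟨w, hw⟩ := HomologicalComplex.exists_pOpcycles_unop_eq
    ((((linearYoneda R (ModuleCat.{u} R)).obj M).rightOp.mapHomologicalComplex _).obj
      (projectiveResolution X).complex) i (i + 1) (by simp) f hf
  exact ⟨_, w, hw, rfl⟩

theorem smul {f : (projectiveResolution X).complex.X i ⟶ M}
    {z : ((Ext R (ModuleCat.{u} R) i).obj (op X)).obj M} (h : ExtRep f z) (r : R) :
    ExtRep (r • f) (r • z) := by
  obtain ⟨w, rfl, rfl⟩ := h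
  exact ⟨r • w, map_smul _ _ _, map_smul _ _ _⟩

theorem unique {f : (projectiveResolution X).complex.X i ⟶ M}
    {z z' : ((Ext R (ModuleCat.{u} R) i).obj (op X)).obj M} (h : ExtRep f z) (h' : ExtRep f z') :
    z = z' := by
  obtain ⟨w, rfl, rfl⟩ := h
  obtain ⟨w', hw, rfl⟩ := h'
  rw [HomologicalComplex.pOpcycles_unop_injective _ _ hw]

theorem eq_zero {f : (projectiveResolution X).complex.X i ⟶ M}
    (h : ExtRep f 0) : ∃ g, f = (projectiveResolution X).complex.d i (i - 1) ≫ g := by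
  obtain ⟨w, rfl, h⟩ := h
  -- For `i = 0` both sides are `0`, and `d 0 0` vanishes: there are no coboundaries.
  have hi : (ComplexShape.down ℕ).next i = i - 1 := by cases i <;> simp
  have hinj : Function.Injective (((linearYoneda R (ModuleCat.{u} R)).obj
      M).rightOp.leftDerivedIsoHomology X i).hom.unop.hom :=
    (ModuleCat.mono_iff_injective _).1 inferInstance
  obtain ⟨g, hg⟩ := (HomologicalComplex.homologyι_unop_eq_zero_iff _ i (i - 1) hi w).1
    (hinj (h.trans (map_zero _).symm))
  exact ⟨g, hg.symm⟩

theorem map {f : (projectiveResolution X).complex.X i ⟶ M}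
    {z : ((Ext R (ModuleCat.{u} R) i).obj (op X)).obj M} (h : ExtRep f z) (φ : M ⟶ N) :
    ExtRep (f ≫ φ) (((Ext R (ModuleCat.{u} R) i).obj (op X)).map φ z) := by
  obtain ⟨w, rfl, rfl⟩ := h
  let α := NatTrans.rightOp ((linearYoneda R (ModuleCat.{u} R)).map φ)
  let ψ := (NatTrans.mapHomologicalComplex α (ComplexShape.down ℕ)).app
    (projectiveResolution X).complex
  refine ⟨(HomologicalComplex.opcyclesMap ψ i).unop.hom w, ?_, ?_⟩
  · have := congrArg (fun a => a.unop.hom w) (HomologicalComplex.p_opcyclesMap ψ i)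
    exact this
  · have h := Functor.leftDerived_app_toOpcycles α X i
    exact (congrArg (fun a => a.unop.hom w) h).symm

theorem comp {f : (projectiveResolution Y).complex.X i ⟶ M}
    {z : ((Ext R (ModuleCat.{u} R) i).obj (op Y)).obj M} (h : ExtRep f z) (a : X ⟶ Y) :
    ExtRep ((ProjectiveResolution.lift a (projectiveResolution X) (projectiveResolution Y)).f i ≫ f)
     (((Ext R (ModuleCat.{u} R) i).map a.op).app M z) := by
  obtain ⟨w, rfl, rfl⟩ := h
  let F := ((linearYoneda R (ModuleCat.{u} R)).obj M).rightOp
  let ψ := (F.mapHomologicalComplex _).map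
    (ProjectiveResolution.lift a (projectiveResolution X) (projectiveResolution Y))
  refine ⟨(HomologicalComplex.opcyclesMap ψ i).unop.hom w, ?_, ?_⟩
  · have := congrArg (fun a => a.unop.hom w) (HomologicalComplex.p_opcyclesMap ψ i)
    exact this
  · have h := F.leftDerived_map_toOpcycles a i
    exact (congrArg (fun a => a.unop.hom w) h).symm

end ExtRep

namespace localCohomology

/-- The quotient of `R` by the `t`-th power of `J`. -/
abbrev quotPow (J : Ideal R) (t : ℕ) : ModuleCat.{u} R :=
  (ringModIdeals (idealPowersDiagram J)).obj (op t)

/-- The projection between the quotients of `R` by powers of `J`. -/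
abbrev quotPowMap (J : Ideal R) {s t : ℕ} (h : t ≤ s) : quotPow J s ⟶ quotPow J t :=
  (ringModIdeals (idealPowersDiagram J)).map (homOfLE h).op

/-- The lift of the projection `R/J^s → R/J^t` to the standard resolutions. -/
noncomputable abbrev resMap (J : Ideal R) {s t : ℕ} (h : t ≤ s) :
    (projectiveResolution (quotPow J s)).complex ⟶ (projectiveResolution (quotPow J t)).complex :=
  ProjectiveResolution.lift (quotPowMap J h) _ _

/-- The cochain `f` on the standard projective resolution of `R/J^t` is a cocycle that
represents the local cohomology class `z`. -/
def Rep {J : Ideal R} {M : ModuleCat.{u} R} {i t : ℕ}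
    (f : (projectiveResolution (quotPow J t)).complex.X i ⟶ M)
    (z : (localCohomology J i).obj M) : Prop :=
  ∃ e, ExtRep f e ∧ ((colimit.ι (diagram (idealPowersDiagram J) i) (op (op t))).app M).hom e = z

/-- The augmentation of the standard resolution of `R/J^t`. -/
noncomputable def aug (J : Ideal R) (t : ℕ) :
    (projectiveResolution (quotPow J t)).complex.X 0 ⟶ quotPow J t :=
  (projectiveResolution (quotPow J t)).π.f 0

instance (J : Ideal R) (t : ℕ) : Epi (aug J t) :=
  inferInstanceAs (Epi ((projectiveResolution (quotPow J t)).π.f 0))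

theorem d_comp_aug (J : Ideal R) (t : ℕ) :
    (projectiveResolution (quotPow J t)).complex.d 1 0 ≫ aug J t = 0 :=
  (projectiveResolution (quotPow J t)).complex_d_comp_π_f_zero

theorem resMap_comp_aug (J : Ideal R) {s t : ℕ} (h : t ≤ s) :
    (resMap J h).f 0 ≫ aug J t = aug J s ≫ quotPowMap J h :=
  ProjectiveResolution.lift_commutes_zero _ _ _

instance : PreservesColimitsOfShape ℕᵒᵖᵒᵖ (forget (ModuleCat.{u} R)) :=
  have : PreservesFilteredColimitsOfSize.{0, 0} (forget (ModuleCat.{u} R)) :=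
    preservesFilteredColimitsOfSize_shrink.{0, u, 0, u} _
  inferInstance

namespace Rep

variable {J : Ideal R} {M N : ModuleCat.{u} R} {i t : ℕ}

/-- Evaluation of the colimit that defines local cohomology. -/
noncomputable def evalIso (J : Ideal R) (M : ModuleCat.{u} R) (i : ℕ) :
    (localCohomology J i).obj M ≅
      colimit (diagram (idealPowersDiagram J) i ⋙ (evaluation _ _).obj M) :=
  colimitObjIsoColimitCompEvaluation (diagram (idealPowersDiagram J) i) M

theorem ι_evalIso (J : Ideal R) (M : ModuleCat.{u} R) (i : ℕ) (t) :
    (colimit.ι (diagram (idealPowersDiagram J) i) t).app M ≫ (evalIso J M i).hom =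
      colimit.ι (diagram (idealPowersDiagram J) i ⋙ (evaluation _ _).obj M) t :=
  colimitObjIsoColimitCompEvaluation_ι_app_hom _ _ _

theorem exists_rep (z : (localCohomology J i).obj M) :
    ∃ t, ∃ f : (projectiveResolution (quotPow J t)).complex.X i ⟶ M, Rep f z := by
  obtain ⟨⟨⟨t⟩⟩, e, he⟩ := Concrete.colimit_exists_rep
    (diagram (idealPowersDiagram J) i ⋙ (evaluation _ _).obj M) ((evalIso J M i).hom z)
  obtain ⟨f, hf⟩ := ExtRep.exists_rep e
  refine ⟨t, f, e, hf, ?_⟩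
  apply (ModuleCat.mono_iff_injective (evalIso J M i).hom).1 inferInstance
  rw [← ι_evalIso] at he
  exact he

theorem eq_zero {f : (projectiveResolution (quotPow J t)).complex.X i ⟶ M}
    (h : Rep f (0 : (localCohomology J i).obj M)) : ∃ s, ∃ hs : t ≤ s, ∃ g,
      (resMap J hs).f i ≫ f = (projectiveResolution (quotPow J s)).complex.d i (i - 1) ≫ g := by
  obtain ⟨e, he, h0⟩ := h
  have h1 := (congrArg (fun a => a.hom e) (ι_evalIso J M i (op (op t)))).symm.trans
    ((congrArg (evalIso J M i).hom.hom h0).trans (map_zero _))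
  obtain ⟨⟨⟨s⟩⟩, w, hw⟩ := Concrete.colimit_rep_eq_zero _
    (diagram (idealPowersDiagram J) i ⋙ (evaluation _ _).obj M) _ _ h1
  have hs : t ≤ s := leOfHom w.unop.unop
  have h2 := he.comp (quotPowMap J hs)
  have h3 : (((Ext R (ModuleCat.{u} R) i).map (quotPowMap J hs).op).app M) e = 0 := hw
  rw [h3] at h2
  exact ⟨s, hs, h2.eq_zero⟩

theorem unique {f : (projectiveResolution (quotPow J t)).complex.X i ⟶ M}
    {z z' : (localCohomology J i).obj M} (h : Rep f z) (h' : Rep f z') : z = z' := by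
  obtain ⟨e, he, rfl⟩ := h
  obtain ⟨e', he', rfl⟩ := h'
  rw [he.unique he']

theorem smul {f : (projectiveResolution (quotPow J t)).complex.X i ⟶ M}
    {z : (localCohomology J i).obj M} (h : Rep f z) (r : R) : Rep (r • f) (r • z) := by
  obtain ⟨e, he, rfl⟩ := h
  exact ⟨_, he.smul r, map_smul _ _ _⟩

theorem d_comp {f : (projectiveResolution (quotPow J t)).complex.X i ⟶ M}
    {z : (localCohomology J i).obj M} (h : Rep f z) (j : ℕ) :
    (projectiveResolution (quotPow J t)).complex.d j i ≫ f = 0 := by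
  obtain ⟨e, he, -⟩ := h
  exact he.d_comp j

theorem exists_of_d_comp (f : (projectiveResolution (quotPow J t)).complex.X i ⟶ M)
    (hf : (projectiveResolution (quotPow J t)).complex.d (i + 1) i ≫ f = 0) :
    ∃ z : (localCohomology J i).obj M, Rep f z := by
  obtain ⟨e, he⟩ := ExtRep.exists_of_d_comp f hf
  exact ⟨_, e, he, rfl⟩

theorem map {f : (projectiveResolution (quotPow J t)).complex.X i ⟶ M}
    {z : (localCohomology J i).obj M} (h : Rep f z) (φ : M ⟶ N) :
    Rep (f ≫ φ) ((localCohomology J i).map φ z) := by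
  obtain ⟨e, he, rfl⟩ := h
  refine ⟨_, he.map φ, ?_⟩
  exact congrArg (fun a => a.hom e)
    ((colimit.ι (diagram (idealPowersDiagram J) i) (op (op t))).naturality φ)

theorem trans {f : (projectiveResolution (quotPow J t)).complex.X i ⟶ M}
    {z : (localCohomology J i).obj M} (h : Rep f z) {s : ℕ} (hs : t ≤ s) :
    Rep ((resMap J hs).f i ≫ f) z := by
  obtain ⟨e, he, rfl⟩ := h
  refine ⟨_, he.comp (quotPowMap J hs), ?_⟩
  exact congrArg (fun a => (a.app M).hom e)
    (colimit.w (diagram (idealPowersDiagram J) i) (homOfLE hs).op.op)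

end Rep

variable (J : Ideal R)

theorem smul_eq_zero_of_forall_smul_eq_zero {M : ModuleCat.{u} R} {r : R}
    (hr : ∀ m : M, r • m = 0) (i : ℕ) (z : (localCohomology J i).obj M) : r • z = 0 := by
  obtain ⟨t, f, hf⟩ := Rep.exists_rep z
  have h1 := hf.smul r
  have h2 := hf.smul 0
  have : r • f = (0 : R) • f := by
    ext m
    simp [hr]
  rw [this] at h1
  rw [h1.unique h2, zero_smul]

/-- If `a` kills `H^i(B)` and `b` kills `H^{i+1}(A)` then `a * b` kills `H^i(C)`, for an exact
sequence `0 → A → B → C → 0`. -/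
theorem smul_eq_zero_of_shortExact {S : ShortComplex (ModuleCat.{u} R)} (hS : S.ShortExact)
    {a b : R} {i : ℕ} (ha : ∀ z : (localCohomology J i).obj S.X₂, a • z = 0)
    (hb : ∀ z : (localCohomology J (i + 1)).obj S.X₁, b • z = 0)
    (z : (localCohomology J i).obj S.X₃) : (a * b) • z = 0 := by
  have := hS.mono_f
  have := hS.epi_g
  obtain ⟨t, f, hf⟩ := Rep.exists_rep z
  -- Chase of the connecting map: the resolution is projective, so the cocycle lifts to a cochain
  -- `g` in `X₂`. Its coboundary comes from a cocycle `k` in `X₁`.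
  obtain ⟨g, rfl⟩ : ∃ g, g ≫ S.g = f := ⟨_, Projective.factorThru_comp f S.g⟩
  have hd : ((projectiveResolution (quotPow J t)).complex.d (i + 1) i ≫ g) ≫ S.g = 0 := by
    rw [Category.assoc, hf.d_comp]
  obtain ⟨k, hk⟩ : ∃ k, k ≫ S.f = _ := ⟨_, hS.exact.lift_f _ hd⟩
  obtain ⟨z', hz'⟩ := Rep.exists_of_d_comp (J := J) k (by
    rw [← cancel_mono S.f, Category.assoc, hk]
    simp)
  have h0 := hz'.smul b
  rw [hb] at h0
  obtain ⟨s, hs, (l : (projectiveResolution (quotPow J s)).complex.X i ⟶ S.X₁),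
    (hl : _ = (projectiveResolution (quotPow J s)).complex.d (i + 1) i ≫ l)⟩ := h0.eq_zero
  -- Over `R/J^s` the cocycle `b • k` is the coboundary of `l`, so this corrected lift of `b • f` is
  -- a cocycle in `X₂`.
  obtain ⟨ζ, hζ⟩ := Rep.exists_of_d_comp (J := J) (b • ((resMap J hs).f i ≫ g) - l ≫ S.f) (by
    rw [Preadditive.comp_sub, Linear.comp_smul, ← Category.assoc, ← Category.assoc, ← hl,
      ← HomologicalComplex.Hom.comm, Category.assoc, ← hk]
    simp)
  have h1 := hζ.map S.g
  have h2 := (hf.trans hs).smul b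
  have h3 : (b • ((resMap J hs).f i ≫ g) - l ≫ S.f) ≫ S.g =
      b • ((resMap J hs).f i ≫ g ≫ S.g) := by
    simp
  rw [h3] at h1
  rw [mul_smul, h2.unique h1, ← map_smul, ha, map_zero]

/-- An element that kills `H^0_J(M)` kills the `J`-torsion of `M`. -/
theorem smul_eq_zero_of_pow_smul_eq_zero {M : ModuleCat.{u} R} {r : R}
    (hr : ∀ z : (localCohomology J 0).obj M, r • z = 0) {t : ℕ} {y : M}
    (hy : ∀ a ∈ J ^ t, a • y = 0) : r • y = 0 := by
  let f : quotPow J t ⟶ M := ModuleCat.ofHom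
    (Submodule.liftQ (J ^ t) (LinearMap.toSpanSingleton R M y) fun a ha => hy a ha)
  obtain ⟨z, hz⟩ := Rep.exists_of_d_comp (J := J) (aug J t ≫ f) (by
    rw [← Category.assoc, d_comp_aug, zero_comp])
  have h0 := hz.smul r
  rw [hr] at h0
  obtain ⟨s, hs, l, hl⟩ := h0.eq_zero
  -- In degree `0` a zero class is represented by a cocycle that becomes zero itself over some
  -- `R/J^s`; evaluation at `1` then recovers `r • y = 0`.
  rw [HomologicalComplex.shape _ _ _ (by simp), zero_comp, Linear.comp_smul, ← Category.assoc,
    resMap_comp_aug, Category.assoc, ← Linear.comp_smul] at hl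
  have h1 : r • quotPowMap J hs ≫ f = 0 := by
    rw [← cancel_epi (aug J s)]
    exact hl.trans comp_zero.symm
  have h2 := congrArg (fun φ => φ.hom (Submodule.Quotient.mk (1 : R))) h1
  have h3 : (quotPowMap J hs ≫ f).hom (Submodule.Quotient.mk (1 : R)) = y := one_smul R y
  exact (congrArg (r • ·) h3).symm.trans h2

end localCohomology

end LocalCohomology

/-! ### Koszul homology and the removal of one element -/

section Koszul

variable {R : Type*} [CommRing R] {n : ℕ} (x : Fin n → R) {M : Type*} [AddCommGroup M] [Module R M]

/-- The Koszul differential on functions defined on all subsets of `Fin n`. -/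
def koszulTotalD (F : Finset (Fin n) → M) (T : Finset (Fin n)) : M :=
  ∑ j, if j ∈ T then 0 else ((-1) ^ (T.filter (· < j)).card * x j) • F (insert j T)

theorem koszulTotalD_eq_koszulD (F : Finset (Fin n) → M) {i : ℕ} {T : Finset (Fin n)}
    (hT : T.card = i) : koszulTotalD x F T = koszulD x M i (fun S => F S.1) ⟨T, hT⟩ := by
  simp only [koszulTotalD, koszulD, LinearMap.coe_mk, AddHom.coe_mk]
  rw [← Finset.sum_subtype (Finset.univ.filter (· ∉ T)) (by simp)
    (fun j => ((-1) ^ (T.filter (· < j)).card * x j) • F (insert j T)), Finset.sum_filter]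
  exact Finset.sum_congr rfl fun j _ => by by_cases h : j ∈ T <;> simp [h]

/-- Functions on all subsets avoid casts between cardinalities; this shows that their values outside
the relevant cardinality do not matter. -/
theorem koszulTotalD_congr {F G : Finset (Fin n) → M} {i : ℕ}
    (h : ∀ S, S.card = i + 1 → F S = G S) {T : Finset (Fin n)} (hT : T.card = i) :
    koszulTotalD x F T = koszulTotalD x G T := by
  refine Finset.sum_congr rfl fun j _ => ?_
  split_ifs with hj
  · rfl
  · rw [h _ (by rw [Finset.card_insert_of_notMem hj, hT])]

theorem koszulTotalD_add (F G : Finset (Fin n) → M) (T) :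
    koszulTotalD x (F + G) T = koszulTotalD x F T + koszulTotalD x G T := by
  rw [koszulTotalD_eq_koszulD x _ rfl, koszulTotalD_eq_koszulD x F rfl,
    koszulTotalD_eq_koszulD x G rfl, ← Pi.add_apply, ← map_add]
  rfl

theorem koszulTotalD_smul (r : R) (F : Finset (Fin n) → M) (T) :
    koszulTotalD x (r • F) T = r • koszulTotalD x F T := by
  rw [koszulTotalD_eq_koszulD x _ rfl, koszulTotalD_eq_koszulD x F rfl, ← Pi.smul_apply,
    ← map_smul]
  rfl

theorem koszulTotalD_comp {N : Type*} [AddCommGroup N] [Module R N] (φ : M →ₗ[R] N)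
    (F : Finset (Fin n) → M) (T) : koszulTotalD x (φ ∘ F) T = φ (koszulTotalD x F T) := by
  simp only [koszulTotalD, map_sum, apply_ite φ, map_zero, map_smul, Function.comp_apply]

theorem koszulTotalD_koszulTotalD (F : Finset (Fin n) → M) (T) :
    koszulTotalD x (koszulTotalD x F) T = 0 := by
  have h := congrFun (LinearMap.congr_fun (koszulD_comp_koszulD x M T.card) fun S => F S.1) ⟨T, rfl⟩
  rw [LinearMap.comp_apply, LinearMap.zero_apply, Pi.zero_apply] at h
  rw [koszulTotalD_eq_koszulD x _ rfl, ← h]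
  exact congrFun (congrArg _ (funext fun S => koszulTotalD_eq_koszulD x F S.2)) _

/-- The ring element `r` kills the Koszul homology in degree `i + 1`. -/
def KoszulKills (x : Fin n → R) (M : Type*) [AddCommGroup M] [Module R M] (i : ℕ) (r : R) : Prop :=
  ∀ F : Finset (Fin n) → M, (∀ T, T.card = i → koszulTotalD x F T = 0) →
    ∃ G, ∀ T, T.card = i + 1 → koszulTotalD x G T = r • F T

theorem koszulKills_top (x : Fin (n + 1) → R) {r : R}
    (h : ∀ y : M, (∀ j, x j • y = 0) → r • y = 0) : KoszulKills x M n r := by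
  intro F hF
  -- At the complement of `j` the differential has the single term `± x j • F univ`.
  have hy : ∀ j, x j • F Finset.univ = 0 := fun j => by
    have := hF (Finset.univ.erase j) (by simp)
    rw [koszulTotalD, Finset.sum_eq_single j (by simp +contextual) (by simp),
      if_neg (by simp), Finset.insert_erase (Finset.mem_univ j), mul_smul] at this
    rcases neg_one_pow_eq_or R (Finset.card {k ∈ Finset.univ.erase j | k < j}) with h | h <;>
      simpa [h] using this
  refine ⟨0, fun T hT => ?_⟩
  obtain rfl : T = Finset.univ := (Finset.card_eq_iff_eq_univ T).1 (by simp [hT])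
  rw [h _ hy]
  simp [koszulTotalD]

section Cons

variable (x : Fin (n + 1) → R) (F : Finset (Fin (n + 1)) → M) (T : Finset (Fin n))

theorem koszulTotalD_map_succ : koszulTotalD x F (T.map (Fin.succEmb n)) =
    x 0 • F (insert 0 (T.map (Fin.succEmb n))) +
      koszulTotalD (Fin.tail x) (fun S => F (S.map (Fin.succEmb n))) T := by
  rw [koszulTotalD, Fin.sum_univ_succ]
  congr 1
  · simp
  · refine Finset.sum_congr rfl fun j _ => ?_
    simp [Finset.filter_map, Fin.tail, Function.comp_def]

theorem koszulTotalD_insert_zero : koszulTotalD x F (insert 0 (T.map (Fin.succEmb n))) =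
    - koszulTotalD (Fin.tail x) (fun S => F (insert 0 (S.map (Fin.succEmb n)))) T := by
  rw [koszulTotalD, Fin.sum_univ_succ, koszulTotalD, ← Finset.sum_neg_distrib]
  simp only [Finset.mem_insert_self, if_true, zero_add]
  refine Finset.sum_congr rfl fun j _ => ?_
  simp [Finset.filter_map, Fin.tail, Function.comp_def, Finset.filter_insert, pow_succ,
    Finset.insert_comm j.succ 0]
  split_ifs <;> simp

theorem Finset.exists_eq_map_succ_or_insert_zero (S : Finset (Fin (n + 1))) :
    (∃ T : Finset (Fin n), S = T.map (Fin.succEmb n)) ∨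
      ∃ T : Finset (Fin n), S = insert 0 (T.map (Fin.succEmb n)) := by
  by_cases h : 0 ∈ S
  · right
    refine ⟨Finset.univ.filter fun j : Fin n => j.succ ∈ S, ?_⟩
    ext j
    refine Fin.cases ?_ (fun j => ?_) j <;> simp [h]
  · left
    refine ⟨Finset.univ.filter fun j : Fin n => j.succ ∈ S, ?_⟩
    ext j
    refine Fin.cases ?_ (fun j => ?_) j <;> simp [h]

omit [AddCommGroup M] in
theorem Finset.exists_extend_map_succ (A B : Finset (Fin n) → M) : ∃ G : Finset (Fin (n + 1)) → M,
    (∀ T, G (T.map (Fin.succEmb n)) = A T) ∧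
      ∀ T, G (insert 0 (T.map (Fin.succEmb n))) = B T := by
  refine ⟨fun S => if 0 ∈ S then B {j : Fin n | j.succ ∈ S} else A {j : Fin n | j.succ ∈ S},
    fun T => ?_, fun T => ?_⟩ <;> simp

/-- Split a cycle into the part `F0` without `e_0` and the coefficient `F1` of `e_0`. Modulo `x 0`
the part `F0` is a cycle, so `a F0 = ∂G0 + x_0 H`. Applying `∂` shows that `x_0` kills `a F1 + ∂H`,
hence so does `b`, and `(b G0, b H)` bounds `ba F`. -/
theorem KoszulKills.cons {a b : R} {i : ℕ}
    (ha : KoszulKills (Fin.tail x) (M ⧸ LinearMap.range (LinearMap.lsmul R M (x 0))) i a)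
    (hb : ∀ y : M, x 0 • y = 0 → b • y = 0) : KoszulKills x M i (b * a) := by
  intro F hF
  set F0 : Finset (Fin n) → M := fun S => F (S.map (Fin.succEmb n)) with hF0
  set F1 : Finset (Fin n) → M := fun S => F (insert 0 (S.map (Fin.succEmb n))) with hF1
  let π := (LinearMap.range (LinearMap.lsmul R M (x 0))).mkQ
  have h0 : ∀ T : Finset (Fin n), T.card = i → koszulTotalD (Fin.tail x) F0 T = - x 0 • F1 T := by
    intro T hT
    have := hF (T.map (Fin.succEmb n)) (by simpa)
    rw [koszulTotalD_map_succ] at this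
    rw [neg_smul]
    exact eq_neg_of_add_eq_zero_right this
  obtain ⟨G', hG'⟩ := ha (π ∘ F0) fun T hT => by
    rw [koszulTotalD_comp, h0 T hT]
    exact (Submodule.Quotient.mk_eq_zero _).2 ⟨-F1 T, by simp⟩
  obtain ⟨G0, rfl⟩ : ∃ G0 : Finset (Fin n) → M, π ∘ G0 = G' :=
    ⟨fun S => (Submodule.mkQ_surjective _ (G' S)).choose,
      funext fun S => (Submodule.mkQ_surjective _ (G' S)).choose_spec⟩
  have hH : ∀ T : Finset (Fin n), ∃ h, T.card = i + 1 →
      a • F0 T = koszulTotalD (Fin.tail x) G0 T + x 0 • h := by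
    intro T
    by_cases hT : T.card = i + 1
    · have h1 := hG' T hT
      rw [koszulTotalD_comp, Function.comp_apply, ← map_smul] at h1
      obtain ⟨h, hh⟩ := (Submodule.Quotient.eq _).1 h1.symm
      refine ⟨h, fun _ => ?_⟩
      rw [← sub_eq_iff_eq_add']
      exact hh.symm
    · exact ⟨0, fun h => absurd h hT⟩
  choose H hH using hH
  have hx : ∀ T : Finset (Fin n), T.card = i →
      b • (a • F1 T + koszulTotalD (Fin.tail x) H T) = 0 := by
    intro T hT
    apply hb
    have h2 := koszulTotalD_congr (Fin.tail x) (F := a • F0)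
      (G := koszulTotalD (Fin.tail x) G0 + x 0 • H) hH hT
    rw [koszulTotalD_add, koszulTotalD_koszulTotalD, zero_add, koszulTotalD_smul,
      koszulTotalD_smul, h0 T hT] at h2
    rw [smul_add, ← h2, neg_smul, smul_neg, smul_comm, add_neg_cancel]
  obtain ⟨G, hGA, hGB⟩ := Finset.exists_extend_map_succ (b • G0) (b • H)
  refine ⟨G, fun S hS => ?_⟩
  rcases Finset.exists_eq_map_succ_or_insert_zero S with ⟨T, rfl⟩ | ⟨T, rfl⟩
  · rw [Finset.card_map] at hS
    rw [koszulTotalD_map_succ, hGB, funext hGA, koszulTotalD_smul, mul_smul]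
    change _ = b • a • F0 T
    rw [hH T hS, Pi.smul_apply, smul_add, smul_comm, add_comm]
  · rw [Finset.card_insert_of_notMem (by simp), Finset.card_map, Nat.add_right_cancel_iff] at hS
    rw [koszulTotalD_insert_zero, funext hGB, koszulTotalD_smul, mul_smul]
    change _ = b • a • F1 T
    have := hx T hS
    rw [smul_add] at this
    exact (eq_neg_of_add_eq_zero_left this).symm

end Cons

end Koszul

theorem koszulComplex_d {R : Type u} [CommRing R] {n : ℕ} (x : Fin n → R)
    (M : Type u) [AddCommGroup M] [Module R M] (i : ℕ) :
    (koszulComplex x M).d (i + 1) i = ModuleCat.ofHom (koszulD x M i) :=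
  ChainComplex.of_d (fun i => ModuleCat.of R (KoszulTerm n M i))
    (fun i => ModuleCat.ofHom (koszulD x M i)) i

theorem KoszulKills.smul_homology_eq_zero {R : Type u} [CommRing R] {n : ℕ} {x : Fin n → R}
    {M : Type u} [AddCommGroup M] [Module R M] {i : ℕ} {r : R} (h : KoszulKills x M i r)
    (z : koszulHomology x M (i + 1)) : r • z = 0 := by
  obtain ⟨w, rfl⟩ := (ModuleCat.epi_iff_surjective
    ((koszulComplex x M).homologyπ (i + 1))).1 inferInstance z
  set f : KoszulTerm n M (i + 1) := ((koszulComplex x M).iCycles (i + 1)).hom w with hf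
  have hdf : koszulD x M i f = 0 := by
    have h1 := congrArg (fun a => a.hom w) ((koszulComplex x M).iCycles_d (i + 1) i)
    rw [koszulComplex_d] at h1
    exact h1
  -- The cycle is extended by zero to subsets of other cardinalities.
  obtain ⟨G, hG⟩ := h (fun S => if hS : S.card = i + 1 then f ⟨S, hS⟩ else 0) fun T hT => by
    rw [koszulTotalD_eq_koszulD x _ hT]
    have : (fun S : {S : Finset (Fin n) // S.card = i + 1} =>
      if hS : S.1.card = i + 1 then f ⟨S.1, hS⟩ else 0) = f := by
      funext S
      rw [dif_pos S.2]
    rw [this, hdf]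
    rfl
  have hg : koszulD x M (i + 1) (fun S => G S.1) = r • f := by
    funext T
    rw [← koszulTotalD_eq_koszulD x G T.2, hG _ T.2, dif_pos T.2]
    rfl
  have hw : ((koszulComplex x M).toCycles (i + 2) (i + 1)).hom (fun S => G S.1) = r • w := by
    apply (ModuleCat.mono_iff_injective ((koszulComplex x M).iCycles (i + 1))).1 inferInstance
    have h1 := congrArg (fun a => a.hom fun S => G S.1)
      ((koszulComplex x M).toCycles_i (i + 2) (i + 1))
    refine h1.trans ?_
    rw [koszulComplex_d]
    exact hg.trans (map_smul _ _ _).symm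
  have h3 := congrArg (fun a => a.hom fun S => G S.1)
    ((koszulComplex x M).toCycles_comp_homologyπ (i + 2) (i + 1))
  exact ((map_smul _ _ _).symm.trans (congrArg _ hw.symm)).trans h3

/-! ### Annihilation of local cohomology at a prime -/

section Localization

variable {R : Type u} [CommRing R] (p : Ideal R) [p.IsPrime]
  {M N K : Type u} [AddCommGroup M] [Module R M] [AddCommGroup N] [Module R N]
  [AddCommGroup K] [Module R K]

/-- The ring element `r` kills the `i`-th local cohomology module of `M` at `p`. -/
def LocalCohomologyKills (M : Type u) [AddCommGroup M] [Module R M] (i : ℕ) (r : R) : Prop :=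
  ∀ z : localCohomologyAtPrime p M i, algebraMap R (Localization.AtPrime p) r • z = 0

variable {p}

theorem LocalCohomologyKills.of_exact {f : N →ₗ[R] M} {g : M →ₗ[R] K}
    (hf : Function.Injective f) (hg : Function.Surjective g) (hfg : Function.Exact f g) {a b : R}
    {i : ℕ} (ha : LocalCohomologyKills p M i a) (hb : LocalCohomologyKills p N (i + 1) b) :
    LocalCohomologyKills p K i (a * b) := by
  intro z
  have hex : Function.Exact (LocalizedModule.map p.primeCompl f)
      (LocalizedModule.map p.primeCompl g) := LocalizedModule.map_exact p.primeCompl f g hfg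
  let S : ShortComplex (ModuleCat.{u} (Localization.AtPrime p)) :=
    ShortComplex.mk (ModuleCat.ofHom (LocalizedModule.map p.primeCompl f))
      (ModuleCat.ofHom (LocalizedModule.map p.primeCompl g))
      (by ext y; exact hex.apply_apply_eq_zero y)
  have hS : S.ShortExact := by
    refine ModuleCat.shortComplex_shortExact S hex ?_ ?_
    · exact LocalizedModule.map_injective _ f hf
    · exact LocalizedModule.map_surjective _ g hg
  rw [map_mul]
  exact localCohomology.smul_eq_zero_of_shortExact _ hS ha hb z

theorem LocalCohomologyKills.of_smul_eq_zero {r : R} (hr : ∀ m : M, r • m = 0) (i : ℕ) :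
    LocalCohomologyKills p M i r := by
  refine localCohomology.smul_eq_zero_of_forall_smul_eq_zero _ (fun m => ?_) i
  induction m using LocalizedModule.induction_on with
  | h m s =>
    change algebraMap R (Localization.AtPrime p) r • LocalizedModule.mk m s = 0
    rw [algebraMap_smul, LocalizedModule.smul'_mk, hr, LocalizedModule.zero_mk]

/-- If `y` vanishes at all primes strictly below `p`, the only prime of `R_p` that can contain its
annihilator is the maximal ideal. A power of that ideal therefore kills `y`, which puts `y` in the
reach of `H^0`. -/
theorem LocalCohomologyKills.exists_notMem_smul_eq_zero [IsNoetherianRing R] {c : R}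
    (hc : LocalCohomologyKills p M 0 c) {y : M}
    (hy : ∀ (q : Ideal R) [q.IsPrime], q < p → ∃ s ∉ q, s • y = 0) : ∃ s ∉ p, s • c • y = 0 := by
  let A := Localization.AtPrime p
  let Y : LocalizedModule p.primeCompl M := LocalizedModule.mkLinearMap p.primeCompl M y
  let I : Ideal A := (Submodule.span A {Y}).annihilator
  have hI : ∀ s : R, s • y = 0 → algebraMap R A s ∈ I := fun s hs => by
    rw [Submodule.mem_annihilator_span_singleton, algebraMap_smul, ← map_smul, hs, map_zero]
  have hrad : p.map (algebraMap R A) ≤ I.radical := by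
    rw [Ideal.radical_eq_sInf]
    refine le_sInf fun Q ⟨hIQ, hQ⟩ => ?_
    rw [Ideal.map_le_iff_le_comap]
    have hle : Q.comap (algebraMap R A) ≤ p := by
      exact (Ideal.comap_mono (IsLocalRing.le_maximalIdeal hQ.ne_top)).trans_eq
        (IsLocalization.AtPrime.under_maximalIdeal A p)
    by_contra h
    obtain ⟨s, hs, hsy⟩ := hy (Q.comap (algebraMap R A)) (lt_of_le_not_ge hle h)
    exact hs (hIQ (hI s hsy))
  obtain ⟨k, hk⟩ := Ideal.exists_pow_le_of_le_radical_of_fg hrad (IsNoetherian.noetherian _)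
  have h := localCohomology.smul_eq_zero_of_pow_smul_eq_zero _
    (M := ModuleCat.of A (LocalizedModule p.primeCompl M)) hc (t := k) (y := Y)
    fun a ha => (Submodule.mem_annihilator_span_singleton _ _).1 (hk ha)
  change algebraMap R A c • Y = 0 at h
  rw [algebraMap_smul, ← map_smul] at h
  obtain ⟨s, hs⟩ := (IsLocalizedModule.eq_zero_iff p.primeCompl _).1 h
  exact ⟨s, s.2, hs⟩

end Localization

/-! ### Climbing through the heights, and the induction on `t` -/

/-- If the primes containing the annihilator of `y` have heights between `m` and `d`, then
`c ^ (d + 1 - m)` kills `y`, provided that `c` kills the `0`-th local cohomology at these primes. -/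
theorem pow_smul_eq_zero_of_localCohomologyKills {R : Type u} [CommRing R]
    [IsNoetherianRing R] {M : Type u} [AddCommGroup M] [Module R M] {c : R} {m d : ℕ}
    (hd : ∀ (p : Ideal R) [p.IsPrime], p.height ≤ d)
    {y : M} (hm : ∀ (p : Ideal R) [p.IsPrime], (∀ s, s • y = 0 → s ∈ p) → m ≤ p.height)
    (hc : ∀ (p : Ideal R) [p.IsPrime], (∀ s, s • y = 0 → s ∈ p) → LocalCohomologyKills p M 0 c) :
    c ^ (d + 1 - m) • y = 0 := by
  -- The conclusion says that `c ^ k • y` vanishes in `M_p`; each unit of height costs one factor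
  -- `c`.
  have key : ∀ k : ℕ, ∀ (p : Ideal R) [p.IsPrime], p.height < (m + k : ℕ) →
      ∃ s ∉ p, s • c ^ k • y = 0 := by
    intro k
    induction k with
    | zero =>
      intro p _ hp
      by_contra! h
      exact absurd (hm p fun s hs => by_contra fun hsp => h s hsp (by simpa using hs))
        (not_le.2 (by simpa using hp))
    | succ k ih =>
      intro p _ hp
      by_cases hy : ∀ s, s • y = 0 → s ∈ p
      · have := (hc p hy).exists_notMem_smul_eq_zero (y := c ^ k • y) fun q _ hq => by
          refine ih q ?_
          have h1 := Ideal.height_strict_mono_of_isPrime_of_isPrime hq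
          rw [← add_assoc, Nat.cast_add_one] at hp
          exact h1.trans_le (Order.le_of_lt_add_one hp)
        simpa only [pow_succ', mul_smul] using this
      · push Not at hy
        obtain ⟨s, hs, hsp⟩ := hy
        exact ⟨s, hsp, by rw [smul_comm, hs, smul_zero]⟩
  by_contra hne
  have hI : (Submodule.span R {c ^ (d + 1 - m) • y}).annihilator ≠ ⊤ := fun h => hne (by
    have h1 := (Ideal.eq_top_iff_one _).1 h
    rwa [Submodule.mem_annihilator_span_singleton, one_smul] at h1)
  obtain ⟨p, hp, hle⟩ := Ideal.exists_le_maximal _ hI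
  have := hp.isPrime
  -- For `k = d + 1 - m` every prime has height below `m + k`, even if the subtraction truncates.
  obtain ⟨s, hs, h0⟩ := key (d + 1 - m) p
    ((hd p).trans_lt (by exact_mod_cast (by omega : d < m + (d + 1 - m))))
  exact hs (hle ((Submodule.mem_annihilator_span_singleton _ _).2 h0))

/-- If `x₁, …, xᵢ` cut down the support of `M` to height at least `k + i`, all heights are at most
`k + δ`, and `c` kills the `i`-th local cohomology of `M` at the primes that contain
`x₁, …, xᵢ₊₁`, then a power of `c` kills the Koszul homology of `M`. -/
theorem koszulKills_of_localCohomologyKills {R : Type u} [CommRing R] [IsNoetherianRing R]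
    (t : ℕ) :
    ∀ {n : ℕ} (x : Fin n → R) (M : Type u) [AddCommGroup M] [Module R M] (c : R) (k δ : ℕ), t < n →
      (∀ (p : Ideal R) [p.IsPrime], p.height ≤ (k + δ : ℕ)) →
      (∀ (p : Ideal R) [hp : p.IsPrime], ⟨p, hp⟩ ∈ Module.support R M → ∀ i ≤ n,
        (∀ j : Fin n, (j : ℕ) < i → x j ∈ p) → (k + i : ℕ) ≤ p.height) →
      (∀ i < n, ∀ (p : Ideal R) [hp : p.IsPrime], ⟨p, hp⟩ ∈ Module.support R M →
        (∀ j : Fin n, (j : ℕ) < i + 1 → x j ∈ p) → LocalCohomologyKills p M i c) →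
      KoszulKills x M (n - t - 1) (c ^ koszulExponent δ n t) := by
  induction t with
  | zero =>
    intro n x M _ _ c k δ hn hd hht hc
    obtain ⟨n, rfl⟩ := Nat.exists_eq_add_one.2 hn
    refine koszulKills_top x fun y hy => ?_
    have hsupp : ∀ (p : Ideal R) [hp : p.IsPrime], (∀ s, s • y = 0 → s ∈ p) →
        ⟨p, hp⟩ ∈ Module.support R M := fun p hp h =>
      Module.mem_support_iff_exists_annihilator.2
        ⟨y, fun s hs => h s ((Submodule.mem_annihilator_span_singleton _ _).1 hs)⟩
    have h1 := pow_smul_eq_zero_of_localCohomologyKills (m := k + (n + 1)) hd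
      (fun p _ h => hht p (hsupp p h) (n + 1) le_rfl fun j _ => h _ (hy j))
      (fun p _ h => hc 0 n.succ_pos p (hsupp p h) fun j _ => h _ (hy j))
    rwa [show k + δ + 1 - (k + (n + 1)) = koszulExponent δ (n + 1) 0 by
      rw [koszulExponent]; omega] at h1
  | succ t ih =>
    intro n x M _ _ c k δ hn hd hht hc
    obtain ⟨n, rfl⟩ : ∃ m, n = m + 1 := ⟨n - 1, by omega⟩
    let φ := LinearMap.lsmul R M (x 0)
    have htors : ∀ y : M, x 0 • y = 0 → c ^ δ • y = 0 := fun y hy => by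
      have hsupp : ∀ (p : Ideal R) [hp : p.IsPrime], (∀ s, s • y = 0 → s ∈ p) →
          ⟨p, hp⟩ ∈ Module.support R M := fun p hp h =>
        Module.mem_support_iff_exists_annihilator.2
          ⟨y, fun s hs => h s ((Submodule.mem_annihilator_span_singleton _ _).1 hs)⟩
      have hx : ∀ (p : Ideal R), (∀ s, s • y = 0 → s ∈ p) →
          ∀ j : Fin (n + 1), (j : ℕ) < 1 → x j ∈ p := fun p h j hj => by
        obtain rfl : j = 0 := Fin.ext (by simpa using hj)
        exact h _ hy
      have h1 := pow_smul_eq_zero_of_localCohomologyKills (m := k + 1) hd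
        (fun p _ h => hht p (hsupp p h) 1 (by omega) (hx p h))
        (fun p _ h => hc 0 n.succ_pos p (hsupp p h) (hx p h))
      rwa [show k + δ + 1 - (k + 1) = δ by omega] at h1
    -- The support condition makes `x 0 ∈ p` automatic for the quotient, so the hypotheses on `M`
    -- pass to it.
    have hQ : ∀ (p : Ideal R) [hp : p.IsPrime],
        ⟨p, hp⟩ ∈ Module.support R (M ⧸ LinearMap.range φ) →
        ⟨p, hp⟩ ∈ Module.support R M ∧ x 0 ∈ p := fun p hp h => by
      refine ⟨Module.support_subset_of_surjective _ (Submodule.mkQ_surjective _) h, ?_⟩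
      obtain ⟨m, hm⟩ := Module.mem_support_iff_exists_annihilator.1 h
      obtain ⟨m, rfl⟩ := Submodule.mkQ_surjective _ m
      refine hm ((Submodule.mem_annihilator_span_singleton _ _).2 ?_)
      rw [← map_smul]
      exact (Submodule.Quotient.mk_eq_zero _).2 ⟨m, rfl⟩
    have hcons : ∀ (p : Ideal R) (i : ℕ), x 0 ∈ p → (∀ j : Fin n, (j : ℕ) < i → Fin.tail x j ∈ p) →
        ∀ j : Fin (n + 1), (j : ℕ) < i + 1 → x j ∈ p := fun p i h0 h j => by
      refine Fin.cases (fun _ => h0) (fun j hj => h j (by simpa using hj)) j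
    -- The bound `k + δ` on heights stays while the shift `k` grows, so `δ` drops by one; at `δ = 0`
    -- truncation only weakens the bound.
    have hrec := ih (Fin.tail x) (M ⧸ LinearMap.range φ) (c ^ (δ + 2)) (k + 1) (δ - 1) (by omega)
      (fun p _ => (hd p).trans (by exact_mod_cast (by omega : k + δ ≤ k + 1 + (δ - 1))))
      (fun p _ h i hi hx => by
        have := hht p (hQ p h).1 (i + 1) (by omega) (hcons p i (hQ p h).2 hx)
        rwa [show k + 1 + i = k + (i + 1) by omega])
      (fun i hi p _ h hx => by
        obtain ⟨hp, h0⟩ := hQ p h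
        -- `c^δ` kills the kernel; the two short exact sequences add one factor `c` each, whence
        -- `c^(δ+2)`.
        have hker : LocalCohomologyKills p (LinearMap.ker φ) (i + 2) (c ^ δ) :=
          .of_smul_eq_zero (fun m => Subtype.ext (htors m m.2)) _
        have hrange : LocalCohomologyKills p (LinearMap.range φ) (i + 1) (c * c ^ δ) :=
          (hc (i + 1) (by omega) p hp (hcons p (i + 1) h0 hx)).of_exact
            (f := (LinearMap.ker φ).subtype) (g := φ.rangeRestrict) (Submodule.subtype_injective _)
            φ.surjective_rangeRestrict
            (LinearMap.exact_iff.2 (by rw [LinearMap.ker_rangeRestrict, Submodule.range_subtype]))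
            hker
        have hquot := (hc i (by omega) p hp fun j hj => hcons p (i + 1) h0 hx j (by omega)).of_exact
          (f := (LinearMap.range φ).subtype) (g := (LinearMap.range φ).mkQ)
          (Submodule.subtype_injective _) (Submodule.mkQ_surjective _)
          (LinearMap.exact_iff.2 (by simp)) hrange
        rwa [show c * (c * c ^ δ) = c ^ (δ + 2) by ring] at hquot)
    have h := KoszulKills.cons x hrec htors
    rwa [← pow_mul, ← pow_add, show n - t - 1 = n + 1 - (t + 1) - 1 by omega] at h

theorem mainTheorem5 {R : Type u} [CommRing R] [IsNoetherianRing R]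
    (d : ℕ) (hdim : ringKrullDim R = d)
    (hcat : IsCatenaryRing R) (hequi : IsLocallyEquidimensionalRing R)
    (n : ℕ) (x : Fin n → R)
    (hht : ∀ i : ℕ, 1 ≤ i → i ≤ n →
      (i : ℕ∞) ≤ (Ideal.span (x '' {j : Fin n | (j : ℕ) < i})).height)
    (M : Type u) [AddCommGroup M] [Module R M] [Module.Finite R M]
    (c : R)
    (hc : ∀ i : ℕ, i < n → ∀ (p : Ideal R) [p.IsPrime],
      (∀ j : Fin n, (j : ℕ) < i + 1 → x j ∈ p) →
      ∀ z : localCohomologyAtPrime p M i,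
        algebraMap R (Localization.AtPrime p) c • z = 0) :
    ∀ t : ℕ, t < n →
      ∀ z : koszulHomology x M (n - t), c ^ koszulExponent d n t • z = 0 := by
  intro t ht
  -- The induction starts with shift `k = 0` and `δ = d`, the dimension bounding all heights.
  have h := koszulKills_of_localCohomologyKills t x M c 0 d ht
    (fun p _ => by
      have := Ideal.height_le_ringKrullDim_of_isPrime (I := p)
      rw [hdim] at this
      rw [zero_add]
      exact_mod_cast this)
    (fun p _ _ i hi hx => by
      rw [zero_add]
      rcases i.eq_zero_or_pos with rfl | h0
      · simp
      · refine (hht i h0 hi).trans (Ideal.height_mono (Ideal.span_le.2 ?_))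
        rintro _ ⟨j, hj, rfl⟩
        exact hx j hj)
    (fun i hi p _ _ hx => hc i hi p hx)
  obtain ⟨i, hi⟩ : ∃ i, n - t = i + 1 := ⟨n - t - 1, by omega⟩
  rw [hi, Nat.add_sub_cancel] at h
  rw [hi]
  exact h.smul_homology_eq_zero
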